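/- Let $d_A,d_B\ge 1$, $\mathcal H_A=\mathbb C^{d_A}$, $\mathcal H_B=\mathbb C^{d_B}$, $d=d_Ad_B$ (for example $d_A=d_B=\sqrt d$), and for $k\ge 1$ let $\pi_{d,k}$ be the law of $\rho=\mathrm{tr}_R|\Psi\rangle\langle\Psi|$, where $|\Psi\rangle$ is a uniformly (Haar) distributed unit vector in $\mathcal H_A\otimes\mathcal H_B\otimes\mathbb C^k$ and $R$ is the third factor. For $\theta$ in the unit sphere $S^{2d-1}\subset\mathbb R^{2d}$ let $|\phi(\theta)\rangle\in\mathcal H_A\otimes\mathcal H_B$ be the unit vector with coordinates $\langle j|\phi(\theta)\rangle=\theta_{2j}+i\,\theta_{2j+1}$, $0\le j<d$. Write $\|A\|_F=\big(\sum_{i,j}|A_{ij}|^2\big)^{1/2}$. Let $\mathcal N$ be a linear map on the operators on $\mathcal H_A$ that is positive (it maps positive semidefinite operators to positive semidefinite operators), and suppose that $W(\theta)=\mathcal N_A\otimes\mathbb I_B(|\phi(\theta)\rangle\langle\phi(\theta)|)$ is non-zero for every $\theta\in S^{2d-1}$. Put $\mathcal M_{\mathcal N}(\theta)=W(\theta)/\|W(\theta)\|_F$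 and suppose that, for some $l>0$, $\|\mathcal M_{\mathcal N}(\theta)-\mathcal M_{\mathcal N}(\theta')\|_F\le l\,\|\theta-\theta'\|_2$ for all $\theta,\theta'\in S^{2d-1}$. Then the minimum $$\alpha_{\min}=\min_{\theta\in S^{2d-1}}\frac{\mathrm{tr}\,W(\theta)}{\sqrt{\mathrm{tr}\,[W(\theta)^2]}}$$ is attained, and the detection capability $$\mathcal C^p_k(\mathcal M_{\mathcal N})=\Pr_{\rho\sim\pi_{d,k}}\big[\exists\,\theta\in S^{2d-1}:\ \mathrm{tr}(\rho\,\mathcal M_{\mathcal N}(\theta))<0\big]$$ satisfies $$\mathcal C^p_k(\mathcal M_{\mathcal N})<2\,e^{C_1-C_2k},\qquad C_1=2d\ln\!\big(2^{2.5}\,d^{1.5}\,l\big),\qquad C_2=\big(\sqrt{0.5+\alpha_{\min}}-1\big)^2 .$$ Moreover, if $\mathcal N$ is the transposition on $\mathcal H_A$ (the PPT criterion, $W(\theta)=|\phi(\theta)\rangle\langle\phi(\theta)|^{\mathrm T_A}$), then $\mathcal N$ is positive, $\|W(\theta)\|_F=1$ for all $\theta\in S^{2d-1}$, $\mathcal M_{\mathcal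 N}=W$ is $\sqrt2$-Lipschitz on $S^{2d-1}$ in the above sense, and $\alpha_{\min}=1$. -/

import Mathlib

open MeasureTheory
open scoped ComplexOrder

noncomputable section

/-- The complex vector with amplitudes `⟨j|φ(θ)⟩ = θ_{(j,0)} + i θ_{(j,1)}`, for a real parameter
vector `θ` with `2 d` coordinates, `d = card ι`.  It is a unit vector iff `‖θ‖₂ = 1`. -/
def stateVector {ι : Type} [Fintype ι] (θ : EuclideanSpace ℝ (ι × Fin 2)) : ι → ℂ :=
  fun j => (θ (j, 0) : ℂ) + (θ (j, 1) : ℂ) * Complex.I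

/-- The rank-one operator `|φ(θ)⟩⟨φ(θ)|`. -/
def pureState {ι : Type} [Fintype ι] (θ : EuclideanSpace ℝ (ι × Fin 2)) : Matrix ι ι ℂ :=
  Matrix.vecMulVec (stateVector θ) (star (stateVector θ))

/-- The unit sphere `S^{2d-1}` of parameters. -/
def paramSphere (ι : Type) [Fintype ι] : Set (EuclideanSpace ℝ (ι × Fin 2)) :=
  Metric.sphere 0 1

/-- The Frobenius norm. -/
def frobNorm {ι : Type} [Fintype ι] (A : Matrix ι ι ℂ) : ℝ :=
  Real.sqrt (∑ i, ∑ j, ‖A i j‖ ^ 2)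

/-- Partial trace over the second tensor factor. -/
def partialTraceRight {ι κ : Type} [Fintype κ] (X : Matrix (ι × κ) (ι × κ) ℂ) : Matrix ι ι ℂ :=
  Matrix.of fun i j => ∑ r, X (i, r) (j, r)

/-- The uniform probability distribution on the unit sphere `S^{2D-1}`, `D = card ι`: the
normalized surface measure.  Through `stateVector` it is the uniform (Haar) distribution
of pure states. -/
def uniformSphere (ι : Type) [Fintype ι] :
    Measure (Metric.sphere (0 : EuclideanSpace ℝ (ι × Fin 2)) 1) :=
  ((volume : Measure (EuclideanSpace ℝ (ι × Fin 2))).toSphere Set.univ)⁻¹ •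
    (volume : Measure (EuclideanSpace ℝ (ι × Fin 2))).toSphere

/-- Matrices carry the product (equivalently, Borel) σ-algebra of their entries. -/
instance matrixMeasurableSpace (ι : Type) : MeasurableSpace (Matrix ι ι ℂ) :=
  inferInstanceAs (MeasurableSpace (ι → ι → ℂ))

/-- The `k`-induced distribution `π_{d,k}` of density matrices on `ℂ^ι`, `d = card ι`: the law of
`ρ = tr_R |φ⟩⟨φ|` for a uniformly distributed pure state `|φ⟩` in `ℂ^ι ⊗ ℂ^k`. -/
def inducedDistribution (ι : Type) [Fintype ι] (k : ℕ) : Measure (Matrix ι ι ℂ) :=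
  (uniformSphere (ι × Fin k)).map fun θ => partialTraceRight (pureState θ.1)

/-- The detection capability of the family `M` of observables with parameters in `Θ`:
`Pr_{ρ ∼ π_{d,k}} [∃ θ ∈ Θ, tr(ρ M(θ)) < 0]`. -/
def detectionCapability {ι P : Type} [Fintype ι] (k : ℕ) (Θ : Set P) (M : P → Matrix ι ι ℂ) : ℝ :=
  (inducedDistribution ι k).real {ρ | ∃ θ ∈ Θ, (ρ * M θ).trace.re < 0}

/-- A linear map of matrices is positive if it maps positive semidefinite matrices to positive
semidefinite matrices. -/
def IsPositiveMap {m : ℕ} (N : Matrix (Fin m) (Fin m) ℂ →ₗ[ℂ] Matrix (Fin m) (Fin m) ℂ) : Prop :=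
  ∀ X : Matrix (Fin m) (Fin m) ℂ, X.PosSemidef → (N X).PosSemidef

/-- `(N_A ⊗ I_B)(X)`: the map `N` acts on each block `(X_{(i,b),(j,b')})_{i,j}`. -/
def applyOnA {m n : ℕ} (N : Matrix (Fin m) (Fin m) ℂ →ₗ[ℂ] Matrix (Fin m) (Fin m) ℂ)
    (X : Matrix (Fin m × Fin n) (Fin m × Fin n) ℂ) :
    Matrix (Fin m × Fin n) (Fin m × Fin n) ℂ :=
  Matrix.of fun p q => N (Matrix.of fun i j => X (i, p.2) (j, q.2)) p.1 q.1

/-- The parameterized witness of a positive map: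
`M_N(θ) = (N_A ⊗ I_B)(|φ(θ)⟩⟨φ(θ)|) / ‖(N_A ⊗ I_B)(|φ(θ)⟩⟨φ(θ)|)‖_F`. -/
def mapWitness {m n : ℕ} (N : Matrix (Fin m) (Fin m) ℂ →ₗ[ℂ] Matrix (Fin m) (Fin m) ℂ)
    (θ : EuclideanSpace ℝ ((Fin m × Fin n) × Fin 2)) :
    Matrix (Fin m × Fin n) (Fin m × Fin n) ℂ :=
  (frobNorm (applyOnA N (pureState θ)))⁻¹ • applyOnA N (pureState θ)

/-- The factor `α(W) = tr W / √(tr W²)` of a Hermitian matrix `W`. -/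
def traceRatio {ι : Type} [Fintype ι] (W : Matrix ι ι ℂ) : ℝ :=
  W.trace.re / Real.sqrt (W * W).trace.re

/-- The values of `α` on the operators `(N_A ⊗ I_B)(|φ(θ)⟩⟨φ(θ)|)`, `θ ∈ S^{2d-1}`. -/
def traceRatios {m : ℕ} (n : ℕ)
    (N : Matrix (Fin m) (Fin m) ℂ →ₗ[ℂ] Matrix (Fin m) (Fin m) ℂ) : Set ℝ :=
  (fun θ => traceRatio (applyOnA N (pureState θ))) '' paramSphere (Fin m × Fin n)

/-- `M` is `l`-Lipschitz on the parameter sphere, from the Euclidean to the Frobenius norm. -/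
def IsLipschitzFrob {ι : Type} [Fintype ι] (l : ℝ)
    (M : EuclideanSpace ℝ (ι × Fin 2) → Matrix ι ι ℂ) : Prop :=
  ∀ θ ∈ paramSphere ι, ∀ θ' ∈ paramSphere ι, frobNorm (M θ - M θ') ≤ l * ‖θ - θ'‖

/-- The transposition map; `applyOnA (transposeMap m)` is the partial transposition `T_A`. -/
def transposeMap (m : ℕ) : Matrix (Fin m) (Fin m) ℂ →ₗ[ℂ] Matrix (Fin m) (Fin m) ℂ :=
  (Matrix.transposeLinearEquiv (Fin m) (Fin m) ℂ ℂ).toLinearMap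

end

/-! For a fixed Hermitian `A`, `tr(ρA)` is a real quadratic form in the purification of `ρ`, a
uniform point of a sphere. The set where a quadratic form is negative is a cone, so its probability
is a ratio of Gaussian integrals, and an exponential tilt bounds it (`toSphere_quadratic_neg_le`).
The form consists of `k` copies of the realification of `A`, so its trace and the sum of its squared
entries are `2k tr A` and `2k ‖A‖_F²`; optimizing the tilt gives the decay `exp(-(√(1+β)-1)² k)`
whenever `‖A‖_F ≤ 1` and `tr A ≥ β ≥ 0` (`uniformSphere_trace_neg_le`).

The existential over `θ` is handled by a finite net. Lowering each witness by `1/(2d)` times the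
identity absorbs an approximation error of `1/(2d)` and costs `1/2` in the trace, whence `0.5 +
α_min` in place of `1 + α_min` (`inducedDistribution_detection_le`). A grid on the sphere has at
most `(X+1)^(2d)` cells with `X = 2^{5/2} d^{3/2} l`, and this is less than `2 X^(2d) = 2 exp(C₁)`
once `X ≥ 4d`, hence as soon as `l ≥ 1`.

Two side conditions must come from positivity and normalization alone. The tilt needs `α_min ≥ 1/2`:
although `W` need not be positive semidefinite, its compressions by vectors of the first factor are,
which yields `‖W‖_F ≤ √2 tr W` (`IsPositiveMap.frobNorm_applyOnA_le`). The counting needs `l ≥ 1`: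
for `d_B ≥ 2` two orthogonal product states have orthogonal witnesses (`one_le_of_isLipschitzFrob`),
while for `d_B = 1` the witnesses are positive semidefinite and detect nothing. -/

/-! ### Gaussian integrals and a Chernoff bound on the sphere -/

/-- The Gaussian weight of a cone is proportional to the surface measure of its trace on the
unit sphere. -/
theorem lintegral_gaussian_cone {E : Type*} [NormedAddCommGroup E] [NormedSpace ℝ E]
    [MeasurableSpace E] [BorelSpace E] [FiniteDimensional ℝ E] [Nontrivial E]
    (μ : Measure E) [μ.IsAddHaarMeasure] {C : Set E} (hC : MeasurableSet C)
    (hcone : ∀ (r : ℝ) (x : E), 0 < r → (r • x ∈ C ↔ x ∈ C)) :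
    ∫⁻ x in C, ENNReal.ofReal (Real.exp (-‖x‖ ^ 2)) ∂μ =
      μ.toSphere {θ | (θ : E) ∈ C} *
        ∫⁻ r : Set.Ioi (0 : ℝ), ENNReal.ofReal (Real.exp (-(r : ℝ) ^ 2))
          ∂Measure.volumeIoiPow (Module.finrank ℝ E - 1) := by
  have hS : MeasurableSet {θ : Metric.sphere (0 : E) 1 | (θ : E) ∈ C} :=
    measurable_subtype_coe hC
  have hf : Measurable fun x : E => ENNReal.ofReal (Real.exp (-‖x‖ ^ 2)) := by fun_prop
  rw [← lintegral_indicator hC, ← lintegral_indicator_one hS,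
    ← lintegral_prod_mul (by fun_prop (disch := assumption)) (by fun_prop)]
  · have hpres := μ.measurePreserving_homeomorphUnitSphereProd
    rw [← hpres.lintegral_comp_emb (Homeomorph.measurableEmbedding _)]
    -- Polar coordinates parametrize the punctured space; the origin is a null set.
    conv_lhs => rw [← restrict_compl_singleton (μ := μ) 0,
      ← lintegral_subtype_comap (measurableSet_singleton (0 : E)).compl]
    refine lintegral_congr fun x => ?_
    have hx : 0 < ‖(x : E)‖ := norm_pos_iff.2 x.2
    have h2 : ‖(x : E)‖⁻¹ • (x : E) ∈ C ↔ (x : E) ∈ C := hcone _ _ (inv_pos.2 hx)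
    by_cases hxC : (x : E) ∈ C
    · simp [Set.indicator, h2, hxC]
    · simp [Set.indicator, h2, hxC]

/-- Write `1/(1+u) = 1 - u + u²/(1+u)`, enlarge the last term using `1 + u ≥ 1 - s`, and apply `1 +
x ≤ exp x`. The quadratic correction is what later produces the Frobenius norm. -/
theorem one_div_one_add_le_exp {u s : ℝ} (hs : s < 1) (hu : -s ≤ u) :
    1 / (1 + u) ≤ Real.exp (-(u - u ^ 2 / (1 - s))) := by
  have h1 : 0 < 1 + u := by linarith
  have h2 : 0 < 1 - s := by linarith
  have h3 : u ^ 2 / (1 + u) ≤ u ^ 2 / (1 - s) := by gcongr; linarith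
  calc 1 / (1 + u) = -(u - u ^ 2 / (1 + u)) + 1 := by field_simp; ring
    _ ≤ -(u - u ^ 2 / (1 - s)) + 1 := by linarith
    _ ≤ _ := Real.add_one_le_exp _

theorem lintegral_exp_neg_sum_mul_sq {n : Type*} [Fintype n] {b : n → ℝ} (hb : ∀ i, 0 < b i) :
    ∫⁻ x : EuclideanSpace ℝ n, ENNReal.ofReal (Real.exp (-∑ i, b i * x i ^ 2)) =
      ENNReal.ofReal (∏ i, √(Real.pi / b i)) := by
  have hmp := (EuclideanSpace.volume_preserving_symm_measurableEquiv_toLp n).symm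
  rw [← hmp.lintegral_comp_emb (MeasurableEquiv.measurableEmbedding _)]
  have h : ∀ x : n → ℝ, Real.exp (-∑ i, b i * x i ^ 2) = ∏ i, Real.exp (-(b i) * x i ^ 2) := by
    intro x
    rw [← Real.exp_sum]; simp
  have hint : Integrable fun x : n → ℝ => ∏ i, Real.exp (-(b i) * x i ^ 2) :=
    Integrable.fintype_prod (fun i => integrable_exp_neg_mul_sq (hb i))
  calc _ = ∫⁻ x : n → ℝ, ENNReal.ofReal (∏ i, Real.exp (-(b i) * x i ^ 2)) :=
        lintegral_congr fun x => by rw [← h]; simp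
    _ = ENNReal.ofReal (∫ x : n → ℝ, ∏ i, Real.exp (-(b i) * x i ^ 2)) := by
        rw [ofReal_integral_eq_lintegral_ofReal hint]
        exact Filter.Eventually.of_forall fun x => Finset.prod_nonneg fun i _ => (Real.exp_pos _).le
    _ = _ := by
        rw [integral_fintype_prod_volume_eq_prod (fun i (y : ℝ) => Real.exp (-(b i) * y ^ 2))]
        simp_rw [integral_gaussian]

/-- Diagonalization of a real quadratic form in an orthonormal basis. -/
theorem exists_orthonormal_diagonalization {n : Type*} [Fintype n] {T : Matrix n n ℝ}
    (hT : T.IsHermitian) :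
    ∃ (b : OrthonormalBasis n ℝ (EuclideanSpace ℝ n)) (ν : n → ℝ),
      (∀ x : EuclideanSpace ℝ n, x.ofLp ⬝ᵥ T.mulVec x.ofLp = ∑ i, ν i * b.repr x i ^ 2) ∧
      ∑ i, ν i = T.trace ∧ ∑ i, ν i ^ 2 = ∑ i, ∑ j, T i j ^ 2 ∧
      ∀ i, (b i).ofLp ⬝ᵥ T.mulVec (b i).ofLp = ν i := by
  classical
  have key : ∀ x : EuclideanSpace ℝ n, x.ofLp ⬝ᵥ T.mulVec x.ofLp =
      ∑ i, hT.eigenvalues i * hT.eigenvectorBasis.repr x i ^ 2 := by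
    intro x
    have hx : x.ofLp = ∑ i, hT.eigenvectorBasis.repr x i • (hT.eigenvectorBasis i).ofLp := by
      conv_lhs => rw [← hT.eigenvectorBasis.sum_repr x]
      simp
    have hTx : T.mulVec x.ofLp = ∑ i, (hT.eigenvectorBasis.repr x i * hT.eigenvalues i) •
        (hT.eigenvectorBasis i).ofLp := by
      conv_lhs => rw [hx]
      simp [Matrix.mulVec_sum, Matrix.mulVec_smul, hT.mulVec_eigenvectorBasis, smul_smul]
    rw [hTx, dotProduct_sum]
    refine Finset.sum_congr rfl fun i _ => ?_
    rw [dotProduct_smul]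
    have : x.ofLp ⬝ᵥ (hT.eigenvectorBasis i).ofLp = hT.eigenvectorBasis.repr x i := by
      rw [OrthonormalBasis.repr_apply_apply, EuclideanSpace.inner_eq_star_dotProduct]
      simp
    rw [this, smul_eq_mul]; ring
  refine ⟨hT.eigenvectorBasis, hT.eigenvalues, key, ?_, ?_, ?_⟩
  · simpa using hT.trace_eq_sum_eigenvalues.symm
  · have h1 : (T * T).trace = ∑ i, ∑ j, T i j ^ 2 := by
      simp only [Matrix.trace, Matrix.diag, Matrix.mul_apply]
      refine Finset.sum_congr rfl fun i _ => Finset.sum_congr rfl fun j _ => ?_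
      rw [show T j i = T i j by simpa using hT.apply i j]; ring
    rw [← h1]
    conv_rhs => rw [hT.spectral_theorem, ← map_mul, Matrix.diagonal_mul_diagonal]
    rw [Unitary.conjStarAlgAut_apply, Matrix.trace_mul_cycle]
    simp [Matrix.trace_diagonal, sq]
  · intro i
    rw [key, Finset.sum_eq_single i] <;> simp +contextual

/-- Chernoff bound for a quadratic form of a uniformly distributed unit vector. -/
theorem toSphere_quadratic_neg_le {n : Type*} [Fintype n] [Nonempty n] {T : Matrix n n ℝ}
    (hT : T.IsHermitian)
    (hb : ∀ x : EuclideanSpace ℝ n, |x.ofLp ⬝ᵥ T.mulVec x.ofLp| ≤ ‖x‖ ^ 2)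
    {s : ℝ} (hs0 : 0 ≤ s) (hs1 : s < 1) :
    (((volume : Measure (EuclideanSpace ℝ n)).toSphere Set.univ)⁻¹ •
      (volume : Measure (EuclideanSpace ℝ n)).toSphere)
        {θ | (θ : EuclideanSpace ℝ n).ofLp ⬝ᵥ T.mulVec (θ : EuclideanSpace ℝ n).ofLp < 0} ≤
      ENNReal.ofReal (Real.exp
        (-(1 / 2) * (s * T.trace - s ^ 2 * (∑ i, ∑ j, T i j ^ 2) / (1 - s)))) := by
  obtain ⟨b, ν, hq, htr, hsq, hν⟩ := exists_orthonormal_diagonalization hT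
  have hν1 : ∀ i, |ν i| ≤ 1 := by
    intro i
    rw [← hν i]
    simpa using hb (b i)
  have hpos : ∀ i, 0 < 1 + s * ν i := by
    intro i
    have := (abs_le.1 (hν1 i)).1
    nlinarith
  set C : Set (EuclideanSpace ℝ n) := {x | x.ofLp ⬝ᵥ T.mulVec x.ofLp < 0} with hCdef
  have hmeas : Measurable fun x : EuclideanSpace ℝ n => x.ofLp ⬝ᵥ T.mulVec x.ofLp := by
    have : Continuous fun x : EuclideanSpace ℝ n => x.ofLp ⬝ᵥ T.mulVec x.ofLp := by
      simp only [dotProduct, Matrix.mulVec]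
      fun_prop
    exact this.measurable
  have hC : MeasurableSet C := measurableSet_lt hmeas measurable_const
  have hcone : ∀ (r : ℝ) (x : EuclideanSpace ℝ n), 0 < r → (r • x ∈ C ↔ x ∈ C) := by
    intro r x hr
    have : (r • x).ofLp ⬝ᵥ T.mulVec (r • x).ofLp = r * r * (x.ofLp ⬝ᵥ T.mulVec x.ofLp) := by
      simp [Matrix.mulVec_smul, mul_assoc]
    simp only [hCdef, Set.mem_ofPred_eq, this]
    constructor
    · intro h; by_contra h'; push Not at h'; nlinarith [mul_pos hr hr, mul_nonneg (mul_pos hr hr).le h']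
    · intro h; exact mul_neg_of_pos_of_neg (mul_pos hr hr) h
  have hnorm : ∀ x : EuclideanSpace ℝ n, ‖x‖ ^ 2 = ∑ i, b.repr x i ^ 2 := by
    intro x
    rw [← b.repr.norm_map x, EuclideanSpace.norm_sq_eq]
    simp
  have h1 := lintegral_gaussian_cone (volume : Measure (EuclideanSpace ℝ n)) hC hcone
  have h2 := lintegral_gaussian_cone (volume : Measure (EuclideanSpace ℝ n))
    MeasurableSet.univ (by simp)
  set c := ∫⁻ r : Set.Ioi (0 : ℝ), ENNReal.ofReal (Real.exp (-(r : ℝ) ^ 2))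
          ∂Measure.volumeIoiPow (Module.finrank ℝ (EuclideanSpace ℝ n) - 1) with hc
  have htot : ∫⁻ x : EuclideanSpace ℝ n, ENNReal.ofReal (Real.exp (-‖x‖ ^ 2)) =
      ENNReal.ofReal (∏ _i : n, √Real.pi) := by
    have := lintegral_exp_neg_sum_mul_sq (n := n) (b := fun _ => 1) (fun _ => one_pos)
    simp only [one_mul, div_one] at this
    rw [← this]
    refine lintegral_congr fun x => ?_
    rw [EuclideanSpace.norm_sq_eq]; simp
  have hcher : ∫⁻ x in C, ENNReal.ofReal (Real.exp (-‖x‖ ^ 2)) ≤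
      ENNReal.ofReal (∏ i, √(Real.pi / (1 + s * ν i))) := by
    rw [← lintegral_exp_neg_sum_mul_sq hpos,
      ← b.measurePreserving_repr.lintegral_comp_emb
        b.repr.toHomeomorph.measurableEmbedding]
    -- On the cone the form is negative, so adding `s` times it to `‖x‖²` only increases the
    -- Gaussian weight; the tilted weight is then integrated over the whole space, where it
    -- factorizes in the eigenbasis.
    refine (setLIntegral_mono' hC fun x hx => ?_).trans (setLIntegral_le_lintegral C _)
    apply ENNReal.ofReal_le_ofReal
    apply Real.exp_le_exp.2
    have hx' : x.ofLp ⬝ᵥ T.mulVec x.ofLp < 0 := hx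
    have : ∑ i, (1 + s * ν i) * b.repr x i ^ 2 = ‖x‖ ^ 2 + s * (x.ofLp ⬝ᵥ T.mulVec x.ofLp) := by
      rw [hnorm, hq, Finset.mul_sum, ← Finset.sum_add_distrib]
      exact Finset.sum_congr rfl fun i _ => by ring
    rw [this]
    nlinarith
  have hprod : ∏ i, √(Real.pi / (1 + s * ν i)) ≤ (∏ _i : n, √Real.pi) * Real.exp
        (-(1 / 2) * (s * T.trace - s ^ 2 * (∑ i, ∑ j, T i j ^ 2) / (1 - s))) := by
    have he : -(1 / 2) * (s * T.trace - s ^ 2 * (∑ i, ∑ j, T i j ^ 2) / (1 - s)) =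
        ∑ i, (-(s * ν i - (s * ν i) ^ 2 / (1 - s))) / 2 := by
      rw [← htr, ← hsq, ← Finset.sum_div, Finset.sum_neg_distrib, Finset.sum_sub_distrib,
        ← Finset.mul_sum, ← Finset.sum_div]
      simp only [mul_pow, ← Finset.mul_sum]
      ring
    rw [he, Real.exp_sum, ← Finset.prod_mul_distrib]
    refine Finset.prod_le_prod (fun i _ => Real.sqrt_nonneg _) fun i _ => ?_
    rw [div_eq_mul_one_div, Real.sqrt_mul Real.pi_pos.le]
    gcongr
    rw [Real.exp_half]
    apply Real.sqrt_le_sqrt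
    apply one_div_one_add_le_exp hs1
    have := (abs_le.1 (hν1 i)).1
    nlinarith
  -- With the whole space as the cone, the radial factor `c` relates the total Gaussian mass to the
  -- total surface measure. Hence `c` is finite and nonzero and cancels from the comparison.
  replace h2 : ENNReal.ofReal (∏ _i : n, √Real.pi) =
      (volume : Measure (EuclideanSpace ℝ n)).toSphere Set.univ * c := by
    rw [← htot, ← setLIntegral_univ]
    exact h2
  rw [h1] at hcher
  have hpi : 0 < ∏ _i : n, √Real.pi := Finset.prod_pos fun _ _ => Real.sqrt_pos.2 Real.pi_pos
  have hne : (volume : Measure (EuclideanSpace ℝ n)).toSphere Set.univ * c ≠ 0 := by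
    have : ENNReal.ofReal (∏ _i : n, √Real.pi) ≠ 0 := (ENNReal.ofReal_pos.2 hpi).ne'
    rwa [h2] at this
  have hnt : (volume : Measure (EuclideanSpace ℝ n)).toSphere Set.univ * c ≠ ⊤ := by
    have : ENNReal.ofReal (∏ _i : n, √Real.pi) ≠ ⊤ := ENNReal.ofReal_ne_top
    rwa [h2] at this
  have hU0 : (volume : Measure (EuclideanSpace ℝ n)).toSphere Set.univ ≠ 0 := left_ne_zero_of_mul hne
  have hUt := measure_ne_top (volume : Measure (EuclideanSpace ℝ n)).toSphere Set.univ
  have hc0 : c ≠ 0 := right_ne_zero_of_mul hne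
  have hct : c ≠ ⊤ := by
    intro h
    rw [h, ENNReal.mul_top hU0] at hnt
    exact hnt rfl
  have hfin : (volume : Measure (EuclideanSpace ℝ n)).toSphere {θ | (θ : EuclideanSpace ℝ n) ∈ C} * c ≤
      (volume : Measure (EuclideanSpace ℝ n)).toSphere Set.univ * ENNReal.ofReal (Real.exp
        (-(1 / 2) * (s * T.trace - s ^ 2 * (∑ i, ∑ j, T i j ^ 2) / (1 - s)))) * c := by
    refine hcher.trans ((ENNReal.ofReal_le_ofReal hprod).trans ?_)
    rw [ENNReal.ofReal_mul hpi.le, h2]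
    apply le_of_eq
    ring
  rw [ENNReal.mul_le_mul_iff_left hc0 hct] at hfin
  rw [Measure.smul_apply, smul_eq_mul]
  calc _ ≤ _ := mul_le_mul_right hfin _
    _ = _ := by rw [← mul_assoc, ENNReal.inv_mul_cancel hU0 hUt, one_mul]

/-! ### Expectation values as quadratic forms, and concentration for one observable -/

theorem frobNorm_nonneg {ι : Type} [Fintype ι] (A : Matrix ι ι ℂ) : 0 ≤ frobNorm A :=
  Real.sqrt_nonneg _

theorem frobNorm_sq {ι : Type} [Fintype ι] (A : Matrix ι ι ℂ) :
    frobNorm A ^ 2 = ∑ i, ∑ j, ‖A i j‖ ^ 2 :=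
  Real.sq_sqrt (by positivity)

theorem frobNorm_smul {ι : Type} [Fintype ι] (c : ℝ) (A : Matrix ι ι ℂ) :
    frobNorm (c • A) = |c| * frobNorm A := by
  rw [← sq_eq_sq₀ (frobNorm_nonneg _) (mul_nonneg (abs_nonneg _) (frobNorm_nonneg _)), mul_pow,
    frobNorm_sq, frobNorm_sq]
  simp [Finset.mul_sum, mul_pow]

theorem frobNorm_pos {ι : Type} [Fintype ι] {A : Matrix ι ι ℂ} (hA : A ≠ 0) : 0 < frobNorm A := by
  refine lt_of_le_of_ne (frobNorm_nonneg A) fun h => hA ?_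
  have h2 := frobNorm_sq A
  rw [← h, zero_pow two_ne_zero, eq_comm,
    Finset.sum_eq_zero_iff_of_nonneg fun _ _ => by positivity] at h2
  ext i j
  have h3 := h2 i (Finset.mem_univ i)
  rw [Finset.sum_eq_zero_iff_of_nonneg fun _ _ => by positivity] at h3
  simpa using h3 j (Finset.mem_univ j)

theorem re_trace_mul_self {ι : Type} [Fintype ι] {A : Matrix ι ι ℂ} (hA : A.IsHermitian) :
    (A * A).trace.re = frobNorm A ^ 2 := by
  rw [frobNorm_sq]
  simp only [Matrix.trace, Matrix.diag, Matrix.mul_apply, Complex.re_sum]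
  refine Finset.sum_congr rfl fun i _ => Finset.sum_congr rfl fun j _ => ?_
  rw [← hA.apply j i, Complex.star_def, Complex.mul_conj, Complex.normSq_eq_norm_sq,
    Complex.ofReal_re]

theorem norm_stateVector_sq {ι : Type} [Fintype ι] (θ : EuclideanSpace ℝ (ι × Fin 2)) (i : ι) :
    ‖stateVector θ i‖ ^ 2 = θ (i, 0) ^ 2 + θ (i, 1) ^ 2 := by
  rw [← Complex.normSq_eq_norm_sq, stateVector, Complex.normSq_add_mul_I]

theorem sum_norm_stateVector_sq {ι : Type} [Fintype ι] (θ : EuclideanSpace ℝ (ι × Fin 2)) :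
    ∑ i, ‖stateVector θ i‖ ^ 2 = ‖θ‖ ^ 2 := by
  simp [EuclideanSpace.norm_sq_eq, Fintype.sum_prod_type, norm_stateVector_sq]

theorem trace_partialTraceRight_mul {ι κ : Type} [Fintype ι] [Fintype κ] (A : Matrix ι ι ℂ)
    (ψ : EuclideanSpace ℝ ((ι × κ) × Fin 2)) :
    (partialTraceRight (pureState ψ) * A).trace =
      ∑ r, ∑ i, ∑ j, star (stateVector ψ (j, r)) * A j i * stateVector ψ (i, r) := by
  simp only [Matrix.trace, Matrix.diag, Matrix.mul_apply, partialTraceRight, pureState,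
    Matrix.of_apply, Matrix.vecMulVec_apply, Pi.star_apply, Finset.sum_mul]
  rw [Finset.sum_comm]
  conv_rhs => rw [Finset.sum_comm]; enter [2, i]; rw [Finset.sum_comm]
  rw [Finset.sum_comm]
  refine Finset.sum_congr rfl fun i _ => Finset.sum_congr rfl fun j _ =>
    Finset.sum_congr rfl fun r _ => by ring

/-- Cauchy–Schwarz over the pairs of indices, separately for each basis vector `r` of the
environment. It serves twice: to bound the form by `‖x‖²` in the Chernoff bound, and to control the
error in the net argument. -/
theorem abs_re_trace_partialTraceRight_mul_le {ι κ : Type} [Fintype ι] [Fintype κ]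
    (A : Matrix ι ι ℂ) (ψ : EuclideanSpace ℝ ((ι × κ) × Fin 2)) :
    |(partialTraceRight (pureState ψ) * A).trace.re| ≤ frobNorm A * ‖ψ‖ ^ 2 := by
  refine (Complex.abs_re_le_norm _).trans ?_
  rw [trace_partialTraceRight_mul, ← sum_norm_stateVector_sq, Fintype.sum_prod_type_right,
    Finset.mul_sum]
  refine (norm_sum_le _ _).trans (Finset.sum_le_sum fun r _ => ?_)
  set φ : ι → ℝ := fun i => ‖stateVector ψ (i, r)‖ with hφ
  calc _ ≤ ∑ i, ∑ j, ‖A j i‖ * (φ j * φ i) := by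
        refine (norm_sum_le _ _).trans (Finset.sum_le_sum fun i _ =>
          (norm_sum_le _ _).trans (Finset.sum_le_sum fun j _ => ?_))
        simp only [norm_mul, norm_star, hφ]
        apply le_of_eq; ring
    _ = ∑ p : ι × ι, ‖A p.1 p.2‖ * (φ p.1 * φ p.2) := by
        rw [Fintype.sum_prod_type_right]
    _ ≤ √(∑ p : ι × ι, ‖A p.1 p.2‖ ^ 2) * √(∑ p : ι × ι, (φ p.1 * φ p.2) ^ 2) :=
        Real.sum_mul_le_sqrt_mul_sqrt _ _ _
    _ = frobNorm A * ∑ i, φ i ^ 2 := by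
        rw [Fintype.sum_prod_type, frobNorm]
        congr 1
        rw [Fintype.sum_prod_type]
        simp only [mul_pow, ← Finset.mul_sum, ← Finset.sum_mul]
        exact Real.sqrt_mul_self (by positivity)

/-- The real symmetric matrix of the quadratic form `ψ ↦ tr (tr_R |ψ⟩⟨ψ| A)`. -/
noncomputable def realForm {ι : Type} (κ : Type) [DecidableEq κ] (A : Matrix ι ι ℂ) :
    Matrix ((ι × κ) × Fin 2) ((ι × κ) × Fin 2) ℝ :=
  Matrix.of fun p q => if p.1.2 = q.1.2 then
    (star ((![1, Complex.I] : Fin 2 → ℂ) p.2) * A p.1.1 q.1.1 *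
      (![1, Complex.I] : Fin 2 → ℂ) q.2).re else 0

theorem realForm_isHermitian {ι κ : Type} [DecidableEq κ] {A : Matrix ι ι ℂ}
    (hA : A.IsHermitian) : (realForm κ A).IsHermitian := by
  ext p q
  simp only [realForm, Matrix.conjTranspose_apply, Matrix.of_apply, star_trivial]
  by_cases h : p.1.2 = q.1.2
  · rw [if_pos h, if_pos h.symm, ← Complex.conj_re]
    congr 1
    rw [← Complex.star_def, star_mul, star_mul, star_star, hA.apply]
    ring
  · rw [if_neg h, if_neg (Ne.symm h)]

theorem dotProduct_realForm_mulVec {ι κ : Type} [Fintype ι] [Fintype κ] [DecidableEq κ]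
    (A : Matrix ι ι ℂ) (ψ : EuclideanSpace ℝ ((ι × κ) × Fin 2)) :
    ψ.ofLp ⬝ᵥ (realForm κ A).mulVec ψ.ofLp =
      (partialTraceRight (pureState ψ) * A).trace.re := by
  rw [trace_partialTraceRight_mul]
  simp only [dotProduct, Matrix.mulVec, realForm, Matrix.of_apply, Fintype.sum_prod_type,
    Fin.sum_univ_two, Complex.re_sum, ite_mul, zero_mul]
  conv_lhs => rw [Finset.sum_comm]
  refine Finset.sum_congr rfl fun r _ => ?_
  conv_rhs => rw [Finset.sum_comm]
  refine Finset.sum_congr rfl fun i _ => ?_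
  simp only [Finset.mul_sum, Finset.sum_add_distrib, Finset.sum_ite_eq, Finset.mem_univ, if_true,
    mul_add]
  simp only [← Finset.sum_add_distrib]
  refine Finset.sum_congr rfl fun j _ => ?_
  simp [stateVector]
  ring

/-- The real form is block diagonal over `κ`, and each block is the realification of `A`, which
doubles the trace; the same count governs the squared entries in `sum_realForm_sq`. -/
theorem trace_realForm {ι κ : Type} [Fintype ι] [Fintype κ] [DecidableEq κ]
    (A : Matrix ι ι ℂ) : (realForm κ A).trace = 2 * Fintype.card κ * A.trace.re := by
  simp only [Matrix.trace, Matrix.diag, realForm, Matrix.of_apply, Fintype.sum_prod_type,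
    Fin.sum_univ_two, Complex.re_sum]
  simp [← Finset.mul_sum, mul_assoc, ← two_mul]
  ring

theorem sum_realForm_sq {ι κ : Type} [Fintype ι] [Fintype κ] [DecidableEq κ]
    (A : Matrix ι ι ℂ) :
    ∑ p, ∑ q, realForm κ A p q ^ 2 = 2 * Fintype.card κ * frobNorm A ^ 2 := by
  rw [frobNorm_sq]
  simp only [realForm, Matrix.of_apply, Fintype.sum_prod_type,
    Fin.sum_univ_two, ← Complex.normSq_eq_norm_sq, Complex.normSq_apply, ite_pow]
  simp only [ne_eq, OfNat.ofNat_ne_zero, not_false_eq_true, zero_pow, Finset.sum_add_distrib,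
    Finset.sum_ite_eq, Finset.mem_univ, if_true]
  simp [← Finset.mul_sum, mul_assoc, sq]
  ring

theorem uniformSphere_trace_neg_le {ι κ : Type} [Fintype ι] [Fintype κ] [Nonempty ι] [Nonempty κ]
    {A : Matrix ι ι ℂ} (hA : A.IsHermitian) (hF : frobNorm A ≤ 1) {β : ℝ} (hβ0 : 0 ≤ β)
    (hβ : β ≤ A.trace.re) :
    uniformSphere (ι × κ) {ψ | (partialTraceRight (pureState ψ.1) * A).trace.re < 0} ≤
      ENNReal.ofReal (Real.exp (-((√(1 + β) - 1) ^ 2 * Fintype.card κ))) := by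
  classical
  -- The exponent per unit of `k` is `sβ - s²/(1-s)`. Its maximum over `0 ≤ s < 1` is at `(1-s)⁻² =
  -- 1 + β`, that is `s = 1 - 1/z`, with value `(z-1)²`.
  set z := √(1 + β) with hz
  have hz2 : z ^ 2 = 1 + β := Real.sq_sqrt (by linarith)
  have hz1 : 1 ≤ z := by rw [hz]; exact Real.one_le_sqrt.2 (by linarith)
  have hz0 : 0 < z := by linarith
  have hs0 : 0 ≤ 1 - 1 / z := by rw [sub_nonneg, div_le_one hz0]; exact hz1
  have hs1 : 1 - 1 / z < 1 := by have := one_div_pos.2 hz0; linarith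
  have h := toSphere_quadratic_neg_le (realForm_isHermitian (κ := κ) hA)
    (fun x => by
      rw [dotProduct_realForm_mulVec]
      exact (abs_re_trace_partialTraceRight_mul_le A x).trans
        (mul_le_of_le_one_left (sq_nonneg _) hF)) hs0 hs1
  simp only [dotProduct_realForm_mulVec, trace_realForm, sum_realForm_sq] at h
  refine h.trans (ENNReal.ofReal_le_ofReal (Real.exp_le_exp.2 ?_))
  have hF2 : frobNorm A ^ 2 ≤ 1 := pow_le_one₀ (frobNorm_nonneg A) hF
  have hid : (z - 1) ^ 2 = (1 - 1 / z) * β - (1 - 1 / z) ^ 2 / (1 / z) := by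
    rw [show β = z ^ 2 - 1 by linarith]
    field_simp
    ring
  rw [hid, show 1 - (1 - 1 / z) = 1 / z by ring]
  have h1 : (1 - 1 / z) * β ≤ (1 - 1 / z) * A.trace.re := by gcongr
  have h2 : (1 - 1 / z) ^ 2 * frobNorm A ^ 2 / (1 / z) ≤ (1 - 1 / z) ^ 2 / (1 / z) := by
    gcongr
    exact mul_le_of_le_one_right (sq_nonneg _) hF2
  have hk : (0 : ℝ) ≤ Fintype.card κ := by positivity
  have h3 := mul_le_mul_of_nonneg_right (sub_le_sub h1 h2) hk
  refine le_trans (le_of_eq ?_) (neg_le_neg h3)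
  ring

/-! ### Positive maps: Hermiticity and a lower bound on the trace ratio -/

open scoped Matrix.Norms.L2Operator MatrixOrder in
-- Positive semidefinite matrices span all matrices over `ℂ`, and on them both sides are fixed by
-- the adjoint. The operator norm only supplies the C*-structure behind the spanning statement.
theorem IsPositiveMap.map_conjTranspose {m : ℕ}
    {N : Matrix (Fin m) (Fin m) ℂ →ₗ[ℂ] Matrix (Fin m) (Fin m) ℂ} (hN : IsPositiveMap N)
    (X : Matrix (Fin m) (Fin m) ℂ) : N X.conjTranspose = (N X).conjTranspose := by
  have hX : X ∈ Submodule.span ℂ {A : Matrix (Fin m) (Fin m) ℂ | 0 ≤ A} := by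
    rw [CStarAlgebra.span_nonneg]; trivial
  induction hX using Submodule.span_induction with
  | mem A hA =>
    have hA' : A.PosSemidef := Matrix.nonneg_iff_posSemidef.1 hA
    rw [hA'.1.eq, (hN A hA').1.eq]
  | zero => simp
  | add A B _ _ hA hB => simp [hA, hB]
  | smul c A _ hA => simp [hA]

theorem IsPositiveMap.applyOnA_isHermitian {m n : ℕ}
    {N : Matrix (Fin m) (Fin m) ℂ →ₗ[ℂ] Matrix (Fin m) (Fin m) ℂ} (hN : IsPositiveMap N)
    {X : Matrix (Fin m × Fin n) (Fin m × Fin n) ℂ} (hX : X.IsHermitian) :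
    (applyOnA N X).IsHermitian := by
  ext p q
  simp only [applyOnA, Matrix.conjTranspose_apply, Matrix.of_apply]
  rw [← Matrix.conjTranspose_apply, ← hN.map_conjTranspose]
  refine congrFun (congrArg _ ?_) _ |> fun h => congrFun h _
  ext i j
  simp [← hX.apply (i, p.2) (j, q.2)]

theorem pureState_isHermitian {ι : Type} [Fintype ι] (θ : EuclideanSpace ℝ (ι × Fin 2)) :
    (pureState θ).IsHermitian := by
  ext p q
  simp [pureState, Matrix.vecMulVec_apply, mul_comm]

/-- This is the nonnegativity of the 2×2 principal minor on rows `i`, `j`; for `i = j` the repeated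
index is harmless. -/
theorem Matrix.PosSemidef.norm_apply_sq_le {n : Type*} {M : Matrix n n ℂ} (hM : M.PosSemidef)
    (i j : n) : ‖M i j‖ ^ 2 ≤ (M i i).re * (M j j).re := by
  have h := (hM.submatrix ![i, j]).det_nonneg
  rw [Matrix.det_fin_two] at h
  have h1 := (Complex.le_def.1 h).1
  have h2 : M j i = star (M i j) := (hM.1.apply j i).symm
  have h3 : (M i i).im = 0 := ((Complex.le_def.1 (hM.diag_nonneg (i := i))).2).symm
  simp only [Matrix.submatrix_apply, Matrix.cons_val_zero, Matrix.cons_val_one, h2,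
    Complex.zero_re, Complex.sub_re, Complex.mul_re, h3, zero_mul, sub_zero, Complex.star_def,
    Complex.conj_re, Complex.conj_im] at h1
  rw [← Complex.normSq_eq_norm_sq, Complex.normSq_apply]
  linarith

theorem star_dotProduct_mulVec {n : Type*} [Fintype n] (A : Matrix n n ℂ) (x : n → ℂ) :
    star (star x ⬝ᵥ A.mulVec x) = star x ⬝ᵥ A.conjTranspose.mulVec x := by
  rw [Matrix.star_dotProduct, Matrix.star_mulVec, ← Matrix.dotProduct_mulVec, star_star]

/-- The scalar compression `(⟨x| ⊗ I) (N ⊗ I)(|φ⟩⟨φ|) (|x⟩ ⊗ I)` is positive semidefinite. -/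
theorem IsPositiveMap.compression_posSemidef {m n : ℕ}
    {N : Matrix (Fin m) (Fin m) ℂ →ₗ[ℂ] Matrix (Fin m) (Fin m) ℂ} (hN : IsPositiveMap N)
    (φ : Fin m × Fin n → ℂ) (x : Fin m → ℂ) :
    (Matrix.of fun b b' : Fin n => star x ⬝ᵥ
      (N (Matrix.vecMulVec (fun i => φ (i, b)) (star fun i => φ (i, b')))).mulVec x).PosSemidef := by
  refine .of_dotProduct_mulVec_nonneg ?_ fun y => ?_
  · ext b b'
    simp only [Matrix.conjTranspose_apply, Matrix.of_apply]
    rw [star_dotProduct_mulVec, ← hN.map_conjTranspose]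
    congr 3
    ext i j
    simp [Matrix.vecMulVec_apply, mul_comm]
  -- Evaluating the compression at `y` contracts the second factor of `φ` against `y`. What remains
  -- is `N` applied to the rank-one matrix of `u`, so positivity of `N` suffices and complete
  -- positivity is not needed.
  · set u : Fin m → ℂ := fun i => ∑ b, star (y b) * φ (i, b) with hu
    have h1 : Matrix.vecMulVec u (star u) = ∑ b, ∑ b', (star (y b) * y b') •
        Matrix.vecMulVec (fun i => φ (i, b)) (star fun i => φ (i, b')) := by
      ext i j
      simp only [Matrix.vecMulVec_apply, hu, Pi.star_apply, star_sum, star_mul', star_star,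
        Finset.sum_mul_sum, Matrix.sum_apply, Matrix.smul_apply, smul_eq_mul]
      refine Finset.sum_congr rfl fun b _ => Finset.sum_congr rfl fun b' _ => by ring
    have h2 := (hN _ (Matrix.posSemidef_vecMulVec_self_star u)).dotProduct_mulVec_nonneg x
    rw [h1] at h2
    simp only [map_sum, map_smul, Matrix.sum_mulVec, dotProduct_sum, Matrix.smul_mulVec,
      dotProduct_smul] at h2
    refine h2.trans_eq ?_
    simp only [dotProduct, Matrix.mulVec, Matrix.of_apply, Pi.star_apply, Finset.mul_sum,
      Finset.sum_mul, smul_eq_mul]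
    refine Finset.sum_congr rfl fun b _ => Finset.sum_congr rfl fun b' _ =>
      Finset.sum_congr rfl fun i _ => Finset.sum_congr rfl fun j _ => by ring

theorem Matrix.IsHermitian.sum_eigenvectorBasis_quadratic {n : Type*} [Fintype n] [DecidableEq n]
    {H : Matrix n n ℂ} (hH : H.IsHermitian) (A : Matrix n n ℂ) :
    ∑ i, star (hH.eigenvectorBasis i).ofLp ⬝ᵥ A.mulVec (hH.eigenvectorBasis i).ofLp = A.trace := by
  set U : Matrix n n ℂ := ↑hH.eigenvectorUnitary with hU
  have h1 : (star U * A * U).trace = A.trace := by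
    rw [Matrix.trace_mul_cycle, hU, Unitary.mul_star_self_of_mem hH.eigenvectorUnitary.2, one_mul]
  rw [← h1]
  refine Finset.sum_congr rfl fun i _ => ?_
  rw [Matrix.diag_apply, Matrix.mul_assoc, Matrix.mul_apply]
  simp only [dotProduct, Matrix.mulVec, Matrix.mul_apply, Matrix.star_apply, Pi.star_apply, hU,
    Matrix.IsHermitian.eigenvectorUnitary_apply]

/-- In an eigenbasis of `H` the squared eigenvalues are bounded by `aᵢ cᵢ`, the products of the
diagonal values of `A` and `C`. Since these are nonnegative, `∑ aᵢ cᵢ ≤ (∑ aᵢ)(∑ cᵢ)`, and both sums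
are traces. -/
theorem Matrix.IsHermitian.sum_norm_sq_le_trace_mul_trace {m : ℕ}
    {A B C H : Matrix (Fin m) (Fin m) ℂ} (hH : H.IsHermitian)
    (hHB : ∀ x : Fin m → ℂ, ‖star x ⬝ᵥ H.mulVec x‖ ≤ ‖star x ⬝ᵥ B.mulVec x‖)
    (hA : ∀ x : Fin m → ℂ, 0 ≤ (star x ⬝ᵥ A.mulVec x).re)
    (hC : ∀ x : Fin m → ℂ, 0 ≤ (star x ⬝ᵥ C.mulVec x).re)
    (hB : ∀ x : Fin m → ℂ, ‖star x ⬝ᵥ B.mulVec x‖ ^ 2 ≤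
      (star x ⬝ᵥ A.mulVec x).re * (star x ⬝ᵥ C.mulVec x).re) :
    ∑ i, ∑ j, ‖H i j‖ ^ 2 ≤ A.trace.re * C.trace.re := by
  have h1 : ∑ i, ∑ j, ‖H i j‖ ^ 2 = ∑ i, hH.eigenvalues i ^ 2 := by
    have h2 : ((H * H).trace).re = ∑ i, ∑ j, ‖H i j‖ ^ 2 := by
      rw [re_trace_mul_self hH, frobNorm_sq]
    rw [← h2]
    conv_lhs => rw [hH.spectral_theorem, ← map_mul, Matrix.diagonal_mul_diagonal]
    rw [Unitary.conjStarAlgAut_apply, Matrix.trace_mul_cycle]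
    simp [Matrix.trace_diagonal, sq]
  rw [h1, ← hH.sum_eigenvectorBasis_quadratic A, ← hH.sum_eigenvectorBasis_quadratic C,
    Complex.re_sum, Complex.re_sum]
  have h3 : ∀ i, hH.eigenvalues i ^ 2 ≤
      (star (hH.eigenvectorBasis i).ofLp ⬝ᵥ A.mulVec (hH.eigenvectorBasis i).ofLp).re *
      (star (hH.eigenvectorBasis i).ofLp ⬝ᵥ C.mulVec (hH.eigenvectorBasis i).ofLp).re := by
    intro i
    refine le_trans ?_ (hB _)
    rw [← sq_abs]
    gcongr
    refine le_trans ?_ (hHB _)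
    rw [hH.eigenvalues_eq]
    exact Complex.abs_re_le_norm _
  refine (Finset.sum_le_sum fun i _ => h3 i).trans ?_
  rw [Finset.sum_mul]
  refine Finset.sum_le_sum fun i _ => ?_
  refine mul_le_mul_of_nonneg_left ?_ (hA _)
  exact Finset.single_le_sum
    (f := fun i => (star (hH.eigenvectorBasis i).ofLp ⬝ᵥ C.mulVec (hH.eigenvectorBasis i).ofLp).re)
    (fun i _ => hC _) (Finset.mem_univ i)

/-- An off-diagonal block `B` need not be Hermitian, so the Hermitian bound is applied to its two
Hermitian parts `H` and `K`. Their quadratic forms are, up to sign, the real and imaginary parts of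
that of `B`, and `‖H‖² + ‖K‖² = ‖B‖²`; hence the factor 2. -/
theorem sum_norm_sq_le_two_mul_trace_mul_trace {m : ℕ} {A B C : Matrix (Fin m) (Fin m) ℂ}
    (hA : ∀ x : Fin m → ℂ, 0 ≤ (star x ⬝ᵥ A.mulVec x).re)
    (hC : ∀ x : Fin m → ℂ, 0 ≤ (star x ⬝ᵥ C.mulVec x).re)
    (hB : ∀ x : Fin m → ℂ, ‖star x ⬝ᵥ B.mulVec x‖ ^ 2 ≤
      (star x ⬝ᵥ A.mulVec x).re * (star x ⬝ᵥ C.mulVec x).re) :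
    ∑ i, ∑ j, ‖B i j‖ ^ 2 ≤ 2 * (A.trace.re * C.trace.re) := by
  set H : Matrix (Fin m) (Fin m) ℂ := (1 / 2 : ℂ) • (B + B.conjTranspose) with hHdef
  set K : Matrix (Fin m) (Fin m) ℂ := (Complex.I / 2) • (B - B.conjTranspose) with hKdef
  have hH : H.IsHermitian := by
    ext i j; simp [H, add_comm]
  have hK : K.IsHermitian := by
    ext i j; simp [K]; ring
  have h1 := hH.sum_norm_sq_le_trace_mul_trace (fun x => by
    simp only [hHdef, Matrix.smul_mulVec, Matrix.add_mulVec, dotProduct_smul, dotProduct_add,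
      ← star_dotProduct_mulVec, norm_smul]
    have := norm_add_le (star x ⬝ᵥ B.mulVec x) (star (star x ⬝ᵥ B.mulVec x))
    rw [norm_star, Complex.star_def] at this
    norm_num
    linarith) hA hC hB
  have h2 := hK.sum_norm_sq_le_trace_mul_trace (fun x => by
    simp only [hKdef, Matrix.smul_mulVec, Matrix.sub_mulVec, dotProduct_smul, dotProduct_sub,
      ← star_dotProduct_mulVec, norm_smul]
    have := norm_sub_le (star x ⬝ᵥ B.mulVec x) (star (star x ⬝ᵥ B.mulVec x))
    rw [norm_star, Complex.star_def] at this
    norm_num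
    linarith) hA hC hB
  have h3 : ∀ i j, ‖H i j‖ ^ 2 + ‖K i j‖ ^ 2 = (‖B i j‖ ^ 2 + ‖B j i‖ ^ 2) / 2 := by
    intro i j
    simp [hHdef, hKdef, mul_pow, ← Complex.normSq_eq_norm_sq, Complex.normSq_apply]
    ring
  have h4 : ∑ i, ∑ j, ‖H i j‖ ^ 2 + ∑ i, ∑ j, ‖K i j‖ ^ 2 = ∑ i, ∑ j, ‖B i j‖ ^ 2 := by
    simp only [← Finset.sum_add_distrib, h3, ← Finset.sum_div]
    rw [show (∑ i, ∑ j, (‖B i j‖ ^ 2 + ‖B j i‖ ^ 2)) =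
      ∑ i, ∑ j, ‖B i j‖ ^ 2 + ∑ i, ∑ j, ‖B j i‖ ^ 2 by simp only [Finset.sum_add_distrib]]
    rw [Finset.sum_comm (f := fun i j => ‖B j i‖ ^ 2)]
    ring
  linarith

/-- The output of `N ⊗ I` on a pure state satisfies `‖W‖_F ≤ √2 tr W`. -/
theorem IsPositiveMap.frobNorm_applyOnA_le {m n : ℕ}
    {N : Matrix (Fin m) (Fin m) ℂ →ₗ[ℂ] Matrix (Fin m) (Fin m) ℂ} (hN : IsPositiveMap N)
    (θ : EuclideanSpace ℝ ((Fin m × Fin n) × Fin 2)) :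
    frobNorm (applyOnA N (pureState θ)) ≤ √2 * (applyOnA N (pureState θ)).trace.re := by
  set φ := stateVector θ
  set X : Fin n → Fin n → Matrix (Fin m) (Fin m) ℂ := fun b b' =>
    N (Matrix.vecMulVec (fun i => φ (i, b)) (star fun i => φ (i, b'))) with hX
  have happ : ∀ p q, applyOnA N (pureState θ) p q = X p.2 q.2 p.1 q.1 := fun p q => rfl
  have hdiag : ∀ b x, 0 ≤ (star x ⬝ᵥ (X b b).mulVec x).re := fun b x =>
    (Complex.le_def.1 ((hN.compression_posSemidef φ x).diag_nonneg (i := b))).1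
  -- For each `x` the compression is a positive semidefinite matrix indexed by `b`, `b'`; its 2×2
  -- minors give the hypothesis relating the block `X b b'` to the two diagonal blocks.
  have h1 : ∀ b b', ∑ i, ∑ j, ‖X b b' i j‖ ^ 2 ≤ 2 * ((X b b).trace.re * (X b' b').trace.re) :=
    fun b b' => sum_norm_sq_le_two_mul_trace_mul_trace (hdiag b) (hdiag b')
      fun x => (hN.compression_posSemidef φ x).norm_apply_sq_le b b'
  have htr : (applyOnA N (pureState θ)).trace.re = ∑ b, (X b b).trace.re := by
    simp only [Matrix.trace, Matrix.diag, happ, Fintype.sum_prod_type_right, Complex.re_sum]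
  have htr0 : 0 ≤ (applyOnA N (pureState θ)).trace.re := by
    rw [htr]
    refine Finset.sum_nonneg fun b _ => ?_
    exact (Complex.le_def.1
      (hN _ (Matrix.posSemidef_vecMulVec_self_star fun i => φ (i, b))).trace_nonneg).1
  refine Real.sqrt_le_iff.2 ⟨by positivity, ?_⟩
  rw [mul_pow, Real.sq_sqrt (by norm_num), htr, sq, Finset.sum_mul_sum, Finset.mul_sum]
  simp only [happ, Fintype.sum_prod_type_right, Finset.mul_sum]
  refine le_trans (le_of_eq ?_)
    (Finset.sum_le_sum fun b _ => Finset.sum_le_sum fun b' _ => h1 b b')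
  refine Finset.sum_congr rfl fun b _ => ?_
  rw [Finset.sum_comm]

/-! ### Nets on the sphere and the union bound -/

/-- A grid net of the Euclidean unit sphere, with grid width `2 / X`. -/
theorem exists_finset_net_sphere {n : Type} [Fintype n] {X : ℝ} (hX : 0 < X) :
    ∃ S : Finset (EuclideanSpace ℝ n), S.card ≤ (⌊X⌋₊ + 1) ^ Fintype.card n ∧
      (∀ θ ∈ S, θ ∈ Metric.sphere (0 : EuclideanSpace ℝ n) 1) ∧
      ∀ θ ∈ Metric.sphere (0 : EuclideanSpace ℝ n) 1,
        ∃ θ' ∈ S, ‖θ - θ'‖ ≤ 2 / X * √(Fintype.card n) := by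
  classical
  have hcoord : ∀ θ ∈ Metric.sphere (0 : EuclideanSpace ℝ n) 1, ∀ i, |θ i| ≤ 1 := by
    intro θ hθ i
    have := PiLp.norm_apply_le θ i
    rwa [mem_sphere_zero_iff_norm.1 hθ] at this
  -- The rescaled coordinate lies in `[0, X]`, so its floor takes at most `⌊X⌋₊ + 1` values, and
  -- points in one cell differ by at most `2 / X` in each coordinate.
  let cell : Metric.sphere (0 : EuclideanSpace ℝ n) 1 → n → Fin (⌊X⌋₊ + 1) := fun θ i =>
    ⟨⌊(θ.1 i + 1) * X / 2⌋₊, by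
      have := (abs_le.1 (hcoord θ.1 θ.2 i)).2
      refine Nat.lt_succ_of_le (Nat.floor_le_floor ?_)
      nlinarith⟩
  -- Only cells that meet the sphere are kept, each represented by one of its points on the sphere,
  -- so the net stays inside the parameter set.
  let rep : Set.range cell → EuclideanSpace ℝ n := fun c => (c.2.choose : EuclideanSpace ℝ n)
  have hclose : ∀ θ θ' : Metric.sphere (0 : EuclideanSpace ℝ n) 1, cell θ = cell θ' →
      ‖(θ : EuclideanSpace ℝ n) - θ'‖ ≤ 2 / X * √(Fintype.card n) := by
    intro θ θ' h
    have h1 : ∀ i, (θ.1 i - θ'.1 i) ^ 2 ≤ (2 / X) ^ 2 := by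
      intro i
      have hf : ⌊(θ.1 i + 1) * X / 2⌋₊ = ⌊(θ'.1 i + 1) * X / 2⌋₊ :=
        congrArg Fin.val (congrFun h i)
      have a1 := (abs_le.1 (hcoord θ.1 θ.2 i)).1
      have a2 := (abs_le.1 (hcoord θ'.1 θ'.2 i)).1
      have p1 : 0 ≤ (θ.1 i + 1) * X / 2 := by
        have : 0 ≤ θ.1 i + 1 := by linarith
        positivity
      have p2 : 0 ≤ (θ'.1 i + 1) * X / 2 := by
        have : 0 ≤ θ'.1 i + 1 := by linarith
        positivity
      have f1 := Nat.floor_le p1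
      have f2 := Nat.lt_floor_add_one ((θ.1 i + 1) * X / 2)
      have f3 := Nat.floor_le p2
      have f4 := Nat.lt_floor_add_one ((θ'.1 i + 1) * X / 2)
      rw [hf] at f1 f2
      apply sq_le_sq'
      · rw [neg_le, ← sub_nonneg]
        have : 0 ≤ (2 / X) * (1 + ((θ.1 i + 1) * X / 2 - (θ'.1 i + 1) * X / 2)) := by
          apply mul_nonneg (by positivity); linarith
        refine this.trans_eq ?_
        field_simp; ring
      · rw [← sub_nonneg]
        have : 0 ≤ (2 / X) * (1 - ((θ.1 i + 1) * X / 2 - (θ'.1 i + 1) * X / 2)) := by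
          apply mul_nonneg (by positivity); linarith
        refine this.trans_eq ?_
        field_simp; ring
    apply (sq_le_sq₀ (norm_nonneg _) (by positivity)).1
    rw [EuclideanSpace.norm_sq_eq, mul_pow, Real.sq_sqrt (by positivity)]
    refine (Finset.sum_le_sum fun i _ => ?_).trans_eq
      (b := ∑ _i : n, (2 / X) ^ 2) (by simp [mul_comm])
    simpa using h1 i
  refine ⟨Finset.univ.image rep, ?_, ?_, ?_⟩
  · refine Finset.card_image_le.trans ?_
    rw [Finset.card_univ]
    refine (Fintype.card_subtype_le _).trans ?_
    simp
  · intro θ hθ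
    obtain ⟨c, -, rfl⟩ := Finset.mem_image.1 hθ
    exact c.2.choose.2
  · intro θ hθ
    have hc : cell ⟨θ, hθ⟩ ∈ Set.range cell := ⟨_, rfl⟩
    refine ⟨rep ⟨_, hc⟩, Finset.mem_image_of_mem _ (Finset.mem_univ _), ?_⟩
    exact hclose ⟨θ, hθ⟩ hc.choose hc.choose_spec.symm

theorem trace_partialTraceRight_pureState {ι κ : Type} [Fintype ι] [Fintype κ]
    (ψ : EuclideanSpace ℝ ((ι × κ) × Fin 2)) :
    (partialTraceRight (pureState ψ)).trace = ((‖ψ‖ ^ 2 : ℝ) : ℂ) := by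
  rw [← sum_norm_stateVector_sq]
  simp only [Matrix.trace, Matrix.diag, partialTraceRight, pureState, Matrix.of_apply,
    Matrix.vecMulVec_apply, Pi.star_apply, Fintype.sum_prod_type, Complex.ofReal_sum,
    ← Complex.normSq_eq_norm_sq, ← Complex.mul_conj, Complex.star_def]

instance matrixOpensMeasurableSpace (ι : Type) [Finite ι] :
    OpensMeasurableSpace (Matrix ι ι ℂ) :=
  inferInstanceAs (OpensMeasurableSpace (ι → ι → ℂ))

theorem continuous_stateVector {ι : Type} [Fintype ι] :
    Continuous (stateVector : EuclideanSpace ℝ (ι × Fin 2) → ι → ℂ) := by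
  unfold stateVector
  fun_prop

theorem continuous_pureState {ι : Type} [Fintype ι] :
    Continuous (pureState : EuclideanSpace ℝ (ι × Fin 2) → Matrix ι ι ℂ) :=
  continuous_stateVector.matrix_vecMulVec continuous_stateVector.star

theorem measurable_partialTraceRight_pureState {ι κ : Type} [Fintype ι] [Fintype κ] :
    Measurable fun ψ : Metric.sphere (0 : EuclideanSpace ℝ ((ι × κ) × Fin 2)) 1 =>
      partialTraceRight (pureState ψ.1) := by
  refine measurable_pi_lambda _ fun i => measurable_pi_lambda _ fun j => ?_
  have h : Continuous fun ψ : Metric.sphere (0 : EuclideanSpace ℝ ((ι × κ) × Fin 2)) 1 =>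
      ∑ r, pureState ψ.1 (i, r) (j, r) :=
    continuous_finsetSum _ fun r _ =>
      (continuous_pureState.comp continuous_subtype_val).matrix_elem (i, r) (j, r)
  exact h.measurable

/-- The detection event is a union of open half-spaces, hence open and measurable although `Θ` may
be uncountable; this permits pulling it back to the sphere. -/
theorem inducedDistribution_detection {ι P : Type} [Fintype ι] (k : ℕ) (Θ : Set P)
    (M : P → Matrix ι ι ℂ) :
    inducedDistribution ι k {ρ | ∃ θ ∈ Θ, (ρ * M θ).trace.re < 0} =
      uniformSphere (ι × Fin k)
        {ψ | ∃ θ ∈ Θ, (partialTraceRight (pureState ψ.1) * M θ).trace.re < 0} := by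
  have hopen : IsOpen {ρ : Matrix ι ι ℂ | ∃ θ ∈ Θ, (ρ * M θ).trace.re < 0} := by
    have : {ρ : Matrix ι ι ℂ | ∃ θ ∈ Θ, (ρ * M θ).trace.re < 0} =
        ⋃ θ ∈ Θ, {ρ | (ρ * M θ).trace.re < 0} := by
      ext; simp
    rw [this]
    refine isOpen_biUnion fun θ _ => isOpen_lt ?_ continuous_const
    exact Complex.continuous_re.comp (continuous_id.matrix_mul continuous_const).matrix_trace
  rw [inducedDistribution, Measure.map_apply measurable_partialTraceRight_pureState
    hopen.measurableSet]
  rfl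

/-- The union bound over a net of observables, with the concentration of each of them. -/
theorem inducedDistribution_detection_le {ι : Type} [Fintype ι] [Nonempty ι] {k : ℕ} (hk : 0 < k)
    {M : EuclideanSpace ℝ (ι × Fin 2) → Matrix ι ι ℂ}
    (hM : ∀ θ ∈ paramSphere ι, (M θ).IsHermitian) (hF : ∀ θ ∈ paramSphere ι, frobNorm (M θ) = 1)
    {a : ℝ} (ha : 1 / 2 ≤ a) (htr : ∀ θ ∈ paramSphere ι, a ≤ (M θ).trace.re)
    {S : Finset (EuclideanSpace ℝ (ι × Fin 2))} (hS : ∀ θ ∈ S, θ ∈ paramSphere ι)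
    (hnet : ∀ θ ∈ paramSphere ι, ∃ θ' ∈ S,
      frobNorm (M θ' - M θ) ≤ 1 / (2 * Fintype.card ι)) :
    inducedDistribution ι k {ρ | ∃ θ ∈ paramSphere ι, (ρ * M θ).trace.re < 0} ≤
      S.card * ENNReal.ofReal (Real.exp (-((√(1 / 2 + a) - 1) ^ 2 * k))) := by
  classical
  have : Nonempty (Fin k) := ⟨⟨0, hk⟩⟩
  have hd : (0 : ℝ) < Fintype.card ι := by exact_mod_cast Fintype.card_pos
  set t : ℝ := 1 / (2 * Fintype.card ι) with ht
  have htd : t * Fintype.card ι = 1 / 2 := by rw [ht]; field_simp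
  have ht0 : 0 < t := by positivity
  -- The shift by `t = 1/(2d)` lowers `tr(ρM)` by exactly `t`, because `tr ρ = 1`, and lowers `tr M`
  -- by `td = 1/2`.
  set M' : EuclideanSpace ℝ (ι × Fin 2) → Matrix ι ι ℂ := fun θ => M θ - (t : ℂ) • 1 with hM'
  have htr' : ∀ θ, (M' θ).trace.re = (M θ).trace.re - 1 / 2 := by
    intro θ
    rw [← htd]
    simp [hM', Matrix.trace_sub, Matrix.trace_smul]
  have hH' : ∀ θ ∈ paramSphere ι, (M' θ).IsHermitian := by
    intro θ hθ
    refine (hM θ hθ).sub ?_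
    simp [Matrix.IsHermitian, Matrix.conjTranspose_smul]
  have hF' : ∀ θ ∈ paramSphere ι, frobNorm (M' θ) ≤ 1 := by
    intro θ hθ
    have h1 : frobNorm (M' θ) ^ 2 = 1 - 2 * t * (M θ).trace.re + t * (1 / 2) := by
      rw [← re_trace_mul_self (hH' θ hθ), ← htd, ← one_pow 2, ← hF θ hθ,
        ← re_trace_mul_self (hM θ hθ)]
      simp [hM', sub_mul, mul_sub, Matrix.trace_sub, Matrix.trace_smul]
      ring
    have h2 := htr θ hθ
    -- The shift does not increase the norm: the change `-2t tr M + t/2` is nonpositive as soon as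
    -- `tr M ≥ 1/4`.
    have h3 : frobNorm (M' θ) ^ 2 ≤ 1 ^ 2 := by rw [h1]; nlinarith
    exact (sq_le_sq₀ (frobNorm_nonneg _) zero_le_one).1 h3
  rw [inducedDistribution_detection]
  -- If `θ` detects `ρ`, a net point `θ'` near it has `tr(ρ M(θ')) < t`, so the shifted observable
  -- at `θ'` is negative.
  have hsub : {ψ : Metric.sphere (0 : EuclideanSpace ℝ ((ι × Fin k) × Fin 2)) 1 |
      ∃ θ ∈ paramSphere ι, (partialTraceRight (pureState ψ.1) * M θ).trace.re < 0} ⊆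
      ⋃ θ ∈ S, {ψ | (partialTraceRight (pureState ψ.1) * M' θ).trace.re < 0} := by
    rintro ψ ⟨θ, hθ, hneg⟩
    obtain ⟨θ', hθ', hdist⟩ := hnet θ hθ
    refine Set.mem_biUnion hθ' ?_
    have hψ : ‖ψ.1‖ = 1 := mem_sphere_zero_iff_norm.1 ψ.2
    have h1 := abs_re_trace_partialTraceRight_mul_le (M θ' - M θ) ψ.1
    have h2 := trace_partialTraceRight_pureState ψ.1
    rw [hψ] at h1 h2
    have h3 := (abs_le.1 h1).2
    simp only [Matrix.mul_sub, Matrix.trace_sub, Complex.sub_re] at h3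
    simp only [Set.mem_ofPred_eq, hM', Matrix.mul_sub, Matrix.trace_sub, Complex.sub_re,
      Matrix.mul_smul, Matrix.mul_one, Matrix.trace_smul, h2]
    simp
    linarith
  refine (measure_mono hsub).trans ((measure_biUnion_finset_le S _).trans ?_)
  rw [← nsmul_eq_mul]
  refine Finset.sum_le_card_nsmul _ _ _ fun θ hθ => ?_
  have h := uniformSphere_trace_neg_le (κ := Fin k) (hH' θ (hS θ hθ)) (hF' θ (hS θ hθ))
    (β := a - 1 / 2) (by linarith) (by rw [htr']; linarith [htr θ (hS θ hθ)])
  rwa [show 1 + (a - 1 / 2) = 1 / 2 + a by ring, Fintype.card_fin] at h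

/-- `(1 + 1/X)^D ≤ exp(D/X) ≤ √e < 2`: this is the source of the prefactor 2 and of the strict
inequality. -/
theorem add_one_pow_lt_two_mul_pow {X : ℝ} {D : ℕ} (hX0 : 0 < X) (hX : 2 * D ≤ X) :
    (X + 1) ^ D < 2 * X ^ D := by
  have h1 : (X + 1) ^ D = X ^ D * (1 / X + 1) ^ D := by
    rw [← mul_pow]; congr 1; field_simp; ring
  have h2 : (1 / X + 1) ^ D ≤ Real.exp (1 / 2) := by
    calc (1 / X + 1) ^ D ≤ Real.exp (1 / X) ^ D := by
          gcongr; exact Real.add_one_le_exp _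
      _ = Real.exp (D * (1 / X)) := (Real.exp_nat_mul _ _).symm
      _ ≤ _ := by
          gcongr
          rw [mul_one_div, div_le_div_iff₀ hX0 two_pos]
          linarith
  have h3 : Real.exp (1 / 2) < 2 := by
    have : Real.exp (1 / 2) ^ 2 < 2 ^ 2 := by
      rw [← Real.exp_nat_mul]
      norm_num
      exact Real.exp_one_lt_d9.trans (by norm_num)
    exact lt_of_pow_lt_pow_left₀ 2 (by norm_num) this
  rw [h1, mul_comm]
  exact mul_lt_mul_of_pos_right (h2.trans_lt h3) (by positivity)

theorem detectionCapability_lt {ι : Type} [Fintype ι] [Nonempty ι] {k : ℕ} (hk : 0 < k)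
    {M : EuclideanSpace ℝ (ι × Fin 2) → Matrix ι ι ℂ}
    (hM : ∀ θ ∈ paramSphere ι, (M θ).IsHermitian) (hF : ∀ θ ∈ paramSphere ι, frobNorm (M θ) = 1)
    {a : ℝ} (ha : 1 / 2 ≤ a) (htr : ∀ θ ∈ paramSphere ι, a ≤ (M θ).trace.re)
    {l : ℝ} (hl : 1 ≤ l) (hlip : IsLipschitzFrob l M) :
    detectionCapability k (paramSphere ι) M <
      2 * Real.exp (2 * (Fintype.card ι : ℝ) *
        Real.log ((2 : ℝ) ^ (5 / 2 : ℝ) * (Fintype.card ι : ℝ) ^ (3 / 2 : ℝ) * l) -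
          (√(1 / 2 + a) - 1) ^ 2 * (k : ℝ)) := by
  have hd1 : (1 : ℝ) ≤ Fintype.card ι := by exact_mod_cast Fintype.card_pos (α := ι)
  have hd : (0 : ℝ) < Fintype.card ι := by linarith
  set d : ℝ := (Fintype.card ι : ℝ) with hddef
  have h2 : (2 : ℝ) ^ (5 / 2 : ℝ) = 4 * √2 := by
    rw [show (5 / 2 : ℝ) = 2 + 1 / 2 by norm_num, Real.rpow_add two_pos, ← Real.sqrt_eq_rpow]
    norm_num
  have h3 : d ^ (3 / 2 : ℝ) = d * √d := by
    rw [show (3 / 2 : ℝ) = 1 + 1 / 2 by norm_num, Real.rpow_add hd, ← Real.sqrt_eq_rpow,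
      Real.rpow_one]
  rw [h2, h3]
  set X : ℝ := 4 * √2 * (d * √d) * l with hX
  have hl0 : 0 < l := by linarith
  have hs2 : 1 ≤ √2 := Real.one_le_sqrt.2 (by norm_num)
  have hsd : 1 ≤ √d := Real.one_le_sqrt.2 hd1
  have hX0 : 0 < X := by positivity
  have hXd : 4 * d ≤ X := by
    calc 4 * d = 4 * 1 * (d * 1) * 1 := by ring
      _ ≤ X := by rw [hX]; gcongr
  obtain ⟨S, hcard, hS, hnet⟩ := exists_finset_net_sphere (n := ι × Fin 2) hX0
  have hcι : Fintype.card (ι × Fin 2) = 2 * Fintype.card ι := by simp [mul_comm]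
  -- This identity dictates `X`: the image of the grid radius under the Lipschitz bound must equal
  -- the tolerance `1/(2d)`.
  have hη : l * (2 / X * √(Fintype.card (ι × Fin 2))) = 1 / (2 * d) := by
    rw [hcι]
    push_cast
    rw [← hddef, Real.sqrt_mul (by norm_num), hX]
    field_simp
    norm_num
  have hbound := inducedDistribution_detection_le hk hM hF ha htr (S := S) hS (fun θ hθ => by
    obtain ⟨θ', hθ', hdist⟩ := hnet θ hθ
    refine ⟨θ', hθ', (hlip θ' (hS θ' hθ') θ hθ).trans ?_⟩
    rw [norm_sub_rev, ← hη]
    gcongr)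
  have hreal : detectionCapability k (paramSphere ι) M ≤
      S.card * Real.exp (-((√(1 / 2 + a) - 1) ^ 2 * k)) := by
    refine ENNReal.toReal_le_of_le_ofReal (by positivity) (hbound.trans_eq ?_)
    rw [ENNReal.ofReal_mul (by positivity), ENNReal.ofReal_natCast]
  refine hreal.trans_lt ?_
  rw [sub_eq_add_neg (2 * d * Real.log X), Real.exp_add, ← mul_assoc]
  refine mul_lt_mul_of_pos_right ?_ (Real.exp_pos _)
  have hexp : Real.exp (2 * d * Real.log X) = X ^ (2 * Fintype.card ι) := by
    rw [show 2 * d * Real.log X = ((2 * Fintype.card ι : ℕ) : ℝ) * Real.log X by push_cast; rfl,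
      Real.exp_nat_mul, Real.exp_log hX0]
  rw [hexp]
  refine lt_of_le_of_lt ?_ (add_one_pow_lt_two_mul_pow hX0 (by push_cast; linarith))
  rw [hcι] at hcard
  calc (S.card : ℝ) ≤ ((⌊X⌋₊ : ℝ) + 1) ^ (2 * Fintype.card ι) := by exact_mod_cast hcard
    _ ≤ _ := by gcongr; exact Nat.floor_le hX0.le

/-! ### Normalized witnesses of positive maps -/

theorem nonempty_paramSphere (ι : Type) [Fintype ι] [Nonempty ι] : (paramSphere ι).Nonempty := by
  classical
  obtain ⟨i⟩ := ‹Nonempty ι›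
  exact ⟨EuclideanSpace.single (i, 0) 1, by simp [paramSphere]⟩

theorem Matrix.IsHermitian.traceRatio_eq {ι : Type} [Fintype ι] {W : Matrix ι ι ℂ}
    (hW : W.IsHermitian) : traceRatio W = W.trace.re / frobNorm W := by
  rw [traceRatio, re_trace_mul_self hW, Real.sqrt_sq (frobNorm_nonneg W)]

theorem continuous_applyOnA_pureState {m n : ℕ}
    (N : Matrix (Fin m) (Fin m) ℂ →ₗ[ℂ] Matrix (Fin m) (Fin m) ℂ) :
    Continuous fun θ : EuclideanSpace ℝ ((Fin m × Fin n) × Fin 2) =>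
      applyOnA N (pureState θ) := by
  refine continuous_matrix fun p q => ?_
  have h : Continuous fun θ : EuclideanSpace ℝ ((Fin m × Fin n) × Fin 2) =>
      (Matrix.of fun i j => pureState θ (i, p.2) (j, q.2) : Matrix (Fin m) (Fin m) ℂ) :=
    continuous_matrix fun i j => continuous_pureState.matrix_elem _ _
  exact (N.continuous_of_finiteDimensional.comp h).matrix_elem _ _

section witness

variable {m n : ℕ} {N : Matrix (Fin m) (Fin m) ℂ →ₗ[ℂ] Matrix (Fin m) (Fin m) ℂ}

theorem frobNorm_mapWitness {θ : EuclideanSpace ℝ ((Fin m × Fin n) × Fin 2)}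
    (h : applyOnA N (pureState θ) ≠ 0) : frobNorm (mapWitness N θ) = 1 := by
  have := frobNorm_pos h
  rw [mapWitness, frobNorm_smul, abs_of_pos (inv_pos.2 this), inv_mul_cancel₀ this.ne']

theorem IsPositiveMap.mapWitness_isHermitian (hN : IsPositiveMap N)
    (θ : EuclideanSpace ℝ ((Fin m × Fin n) × Fin 2)) : (mapWitness N θ).IsHermitian := by
  rw [Matrix.IsHermitian, mapWitness, Matrix.conjTranspose_smul,
    (hN.applyOnA_isHermitian (pureState_isHermitian θ)).eq, star_trivial]

theorem IsPositiveMap.re_trace_mapWitness (hN : IsPositiveMap N)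
    (θ : EuclideanSpace ℝ ((Fin m × Fin n) × Fin 2)) :
    (mapWitness N θ).trace.re = traceRatio (applyOnA N (pureState θ)) := by
  rw [(hN.applyOnA_isHermitian (pureState_isHermitian θ)).traceRatio_eq, mapWitness,
    Matrix.trace_smul, Complex.smul_re, smul_eq_mul, div_eq_inv_mul]

/-- The bound `‖W‖_F ≤ √2 tr W` gives `1/√2`; only `1/2` is kept, exactly enough for the shifted
observables to have nonnegative trace. -/
theorem IsPositiveMap.half_le_traceRatio (hN : IsPositiveMap N)
    {θ : EuclideanSpace ℝ ((Fin m × Fin n) × Fin 2)} (h : applyOnA N (pureState θ) ≠ 0) :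
    1 / 2 ≤ traceRatio (applyOnA N (pureState θ)) := by
  have h0 := frobNorm_pos h
  rw [(hN.applyOnA_isHermitian (pureState_isHermitian θ)).traceRatio_eq, le_div_iff₀ h0]
  have h1 := hN.frobNorm_applyOnA_le θ
  have h2 : √2 ≤ 2 := Real.sqrt_le_iff.2 ⟨by norm_num, by norm_num⟩
  have h3 : 0 ≤ (applyOnA N (pureState θ)).trace.re := by
    by_contra hneg
    push Not at hneg
    have := mul_neg_of_pos_of_neg (Real.sqrt_pos.2 (two_pos (α := ℝ))) hneg
    linarith
  have h4 := mul_le_mul_of_nonneg_right h2 h3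
  linarith

theorem IsPositiveMap.exists_isLeast_traceRatios [NeZero m] [NeZero n] (hN : IsPositiveMap N)
    (hW : ∀ θ ∈ paramSphere (Fin m × Fin n), applyOnA N (pureState θ) ≠ 0) :
    ∃ a, IsLeast (traceRatios n N) a := by
  have hc : ContinuousOn (fun θ => traceRatio (applyOnA N (pureState θ)))
      (paramSphere (Fin m × Fin n)) := by
    have hW' := continuous_applyOnA_pureState (n := n) N
    refine ContinuousOn.div
      (Complex.continuous_re.comp hW'.matrix_trace).continuousOn
      (Real.continuous_sqrt.comp
        (Complex.continuous_re.comp (hW'.matrix_mul hW').matrix_trace)).continuousOn fun θ hθ => ?_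
    rw [re_trace_mul_self (hN.applyOnA_isHermitian (pureState_isHermitian θ)),
      Real.sqrt_sq (frobNorm_nonneg _)]
    exact (frobNorm_pos (hW θ hθ)).ne'
  exact ((isCompact_sphere _ _).image_of_continuousOn hc).exists_isLeast
    ((nonempty_paramSphere _).image _)

theorem mapWitness_single_eq_zero (a : Fin m) (b : Fin n) {p q : Fin m × Fin n}
    (h : p.2 ≠ b) : mapWitness N (EuclideanSpace.single ((a, b), 0) 1) p q = 0 := by
  have : (Matrix.of fun i j => pureState (EuclideanSpace.single ((a, b), (0 : Fin 2)) (1 : ℝ))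
      (i, p.2) (j, q.2) : Matrix (Fin m) (Fin m) ℂ) = 0 := by
    ext i j
    simp [pureState, Matrix.vecMulVec_apply, stateVector, h]
  simp [mapWitness, applyOnA, this]

/-- If the second factor is at least two-dimensional, then the normalized witnesses of two
orthogonal product states are orthogonal, so that the Lipschitz constant is at least one. -/
theorem one_le_of_isLipschitzFrob [NeZero m] (hn : 2 ≤ n)
    (hW : ∀ θ ∈ paramSphere (Fin m × Fin n), applyOnA N (pureState θ) ≠ 0) {l : ℝ}
    (hlip : IsLipschitzFrob (ι := Fin m × Fin n) l (mapWitness N)) : 1 ≤ l := by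
  set θ : Fin n → EuclideanSpace ℝ ((Fin m × Fin n) × Fin 2) := fun b =>
    EuclideanSpace.single ((0, b), 0) 1 with hθ
  have hmem : ∀ b, θ b ∈ paramSphere (Fin m × Fin n) := fun b => by simp [paramSphere, hθ]
  let b : Fin n := ⟨0, by omega⟩
  let b' : Fin n := ⟨1, by omega⟩
  have hbb : b ≠ b' := by simp [b, b']
  have h1 : frobNorm (mapWitness N (θ b) - mapWitness N (θ b')) ^ 2 = 2 := by
    have hb := frobNorm_mapWitness (hW _ (hmem b))
    have hb' := frobNorm_mapWitness (hW _ (hmem b'))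
    -- The two witnesses are supported on disjoint sets of rows, so no cross terms occur; both
    -- distances then equal `√2`, which forces `l ≥ 1`.
    have : frobNorm (mapWitness N (θ b) - mapWitness N (θ b')) ^ 2 =
        frobNorm (mapWitness N (θ b)) ^ 2 + frobNorm (mapWitness N (θ b')) ^ 2 := by
      simp only [frobNorm_sq, ← Finset.sum_add_distrib]
      refine Finset.sum_congr rfl fun p _ => Finset.sum_congr rfl fun q _ => ?_
      rw [Matrix.sub_apply]
      by_cases hp : p.2 = b
      · rw [mapWitness_single_eq_zero 0 b' (fun h => hbb (hp.symm.trans h))]; simp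
      · rw [mapWitness_single_eq_zero 0 b hp]; simp
    rw [this, hb, hb']; norm_num
  have h2 : ‖θ b - θ b'‖ ^ 2 = 2 := by
    rw [@norm_sub_sq_real]
    simp [hθ, hbb, EuclideanSpace.inner_single_left]
    norm_num
  have h3 := hlip _ (hmem b) _ (hmem b')
  have e1 := Real.sqrt_sq (frobNorm_nonneg (mapWitness N (θ b) - mapWitness N (θ b')))
  have e2 := Real.sqrt_sq (norm_nonneg (θ b - θ b'))
  rw [h1] at e1
  rw [h2] at e2
  rw [← e1, ← e2] at h3
  exact (le_mul_iff_one_le_left (Real.sqrt_pos.2 two_pos)).1 h3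

/-- With a trivial second factor the witness is, up to reindexing and scaling, `N` of a rank-one
positive matrix. This case is separate because `l` may be arbitrarily small here, for instance for a
constant witness family. -/
theorem IsPositiveMap.detectionCapability_eq_zero
    {N : Matrix (Fin m) (Fin m) ℂ →ₗ[ℂ] Matrix (Fin m) (Fin m) ℂ} (hN : IsPositiveMap N) (k : ℕ) :
    detectionCapability k (paramSphere (Fin m × Fin 1)) (mapWitness N) = 0 := by
  rw [detectionCapability, Measure.real, inducedDistribution_detection]
  have hpsd : ∀ θ : EuclideanSpace ℝ ((Fin m × Fin 1) × Fin 2), (mapWitness N θ).PosSemidef := by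
    intro θ
    have h1 : applyOnA N (pureState θ) =
        (N (Matrix.vecMulVec (fun i => stateVector θ (i, 0))
          (star fun i => stateVector θ (i, 0)))).submatrix Prod.fst Prod.fst := by
      ext ⟨i, x⟩ ⟨j, y⟩
      rw [Subsingleton.elim x 0, Subsingleton.elim y 0]
      rfl
    rw [mapWitness, h1]
    exact ((hN _ (Matrix.posSemidef_vecMulVec_self_star _)).submatrix _).smul
      (inv_nonneg.2 (frobNorm_nonneg _))
  rw [Set.eq_empty_of_forall_notMem (s := {ψ | _}), measure_empty, ENNReal.toReal_zero]
  rintro ψ ⟨θ, -, hneg⟩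
  refine hneg.not_ge ?_
  rw [trace_partialTraceRight_mul, Complex.re_sum]
  refine Finset.sum_nonneg fun r _ => ?_
  have h := (Complex.le_def.1
    ((hpsd θ).dotProduct_mulVec_nonneg fun i => stateVector ψ.1 (i, r))).1
  refine h.trans_eq ?_
  rw [Finset.sum_comm]
  simp only [dotProduct, Matrix.mulVec, Finset.mul_sum, Pi.star_apply, mul_assoc]

end witness

/-! ### Partial transposition -/

theorem isPositiveMap_transposeMap (m : ℕ) : IsPositiveMap (transposeMap m) :=
  fun _ hX => hX.transpose

theorem applyOnA_transposeMap_apply {m n : ℕ} (X : Matrix (Fin m × Fin n) (Fin m × Fin n) ℂ)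
    (p q : Fin m × Fin n) :
    applyOnA (transposeMap m) X p q = X (q.1, p.2) (p.1, q.2) := rfl

/-- Partial transposition only permutes the entries, so norms and Lipschitz constants reduce to
those of the pure states themselves. -/
theorem frobNorm_applyOnA_transposeMap {m n : ℕ}
    (X : Matrix (Fin m × Fin n) (Fin m × Fin n) ℂ) :
    frobNorm (applyOnA (transposeMap m) X) = frobNorm X := by
  simp only [frobNorm, applyOnA_transposeMap_apply, Fintype.sum_prod_type]
  congr 1
  conv_rhs => rw [Finset.sum_comm]; enter [2, b]; rw [Finset.sum_comm]
  conv_lhs => rw [Finset.sum_comm]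

theorem frobNorm_pureState {ι : Type} [Fintype ι] (θ : EuclideanSpace ℝ (ι × Fin 2)) :
    frobNorm (pureState θ) = ‖θ‖ ^ 2 := by
  rw [← sq_eq_sq₀ (frobNorm_nonneg _) (sq_nonneg _), frobNorm_sq, ← sum_norm_stateVector_sq, sq,
    Finset.sum_mul_sum]
  simp [pureState, Matrix.vecMulVec_apply, mul_pow]

theorem trace_pureState {ι : Type} [Fintype ι] (θ : EuclideanSpace ℝ (ι × Fin 2)) :
    (pureState θ).trace = ((‖θ‖ ^ 2 : ℝ) : ℂ) := by
  rw [← sum_norm_stateVector_sq]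
  simp [Matrix.trace, pureState, Matrix.vecMulVec_apply, Complex.mul_conj,
    Complex.normSq_eq_norm_sq]

/-- With overlap `z`, the squared distances are `2 - 2|z|²` for the projectors and `2 - 2 Re z` for
the parameters. The claim follows from `|z|² ≥ (Re z)²` and `(1 - Re z)² ≥ 0`. -/
theorem frobNorm_pureState_sub_le {ι : Type} [Fintype ι] {θ θ' : EuclideanSpace ℝ (ι × Fin 2)}
    (hθ : θ ∈ paramSphere ι) (hθ' : θ' ∈ paramSphere ι) :
    frobNorm (pureState θ - pureState θ') ≤ √2 * ‖θ - θ'‖ := by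
  have n1 : ‖θ‖ = 1 := mem_sphere_zero_iff_norm.1 hθ
  have n2 : ‖θ'‖ = 1 := mem_sphere_zero_iff_norm.1 hθ'
  set φ := stateVector θ with hφ
  set φ' := stateVector θ' with hφ'
  set z : ℂ := ∑ p, φ p * star (φ' p) with hz
  have s1 : ∑ p, ‖φ p‖ ^ 2 = 1 := by rw [hφ, sum_norm_stateVector_sq, n1, one_pow]
  have s2 : ∑ p, ‖φ' p‖ ^ 2 = 1 := by rw [hφ', sum_norm_stateVector_sq, n2, one_pow]
  have h1 : frobNorm (pureState θ - pureState θ') ^ 2 = 2 - 2 * ‖z‖ ^ 2 := by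
    have hpt : ∀ p q, ‖(pureState θ - pureState θ') p q‖ ^ 2 =
        ‖φ p‖ ^ 2 * ‖φ q‖ ^ 2 + ‖φ' p‖ ^ 2 * ‖φ' q‖ ^ 2 -
          2 * ((φ p * star (φ' p)) * star (φ q * star (φ' q))).re := by
      intro p q
      rw [Matrix.sub_apply, ← Complex.normSq_eq_norm_sq, Complex.normSq_sub]
      simp only [pureState, Matrix.vecMulVec_apply, Pi.star_apply, map_mul,
        Complex.normSq_eq_norm_sq, Complex.star_def, RCLike.norm_conj,
        Complex.conj_conj, hφ, hφ']
      congr 3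
      ring
    rw [frobNorm_sq]
    simp only [hpt, Finset.sum_sub_distrib, Finset.sum_add_distrib, ← Finset.mul_sum,
      ← Finset.sum_mul, s1, s2, ← Complex.re_sum]
    rw [← star_sum, ← hz, Complex.star_def, Complex.mul_conj, Complex.ofReal_re,
      Complex.normSq_eq_norm_sq]
    norm_num
  have h2 : ‖θ - θ'‖ ^ 2 = 2 - 2 * z.re := by
    have hpt : ∀ p, ‖stateVector (θ - θ') p‖ ^ 2 =
        ‖φ p‖ ^ 2 + ‖φ' p‖ ^ 2 - 2 * (φ p * star (φ' p)).re := by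
      intro p
      have : stateVector (θ - θ') p = φ p - φ' p := by
        simp [stateVector, hφ, hφ']; ring
      rw [this, ← Complex.normSq_eq_norm_sq, Complex.normSq_sub]
      simp only [Complex.normSq_eq_norm_sq, Complex.star_def]
    rw [← sum_norm_stateVector_sq]
    simp only [hpt, Finset.sum_sub_distrib, Finset.sum_add_distrib, ← Finset.mul_sum, s1, s2,
      ← Complex.re_sum]
    rw [← hz]
    ring
  rw [← sq_le_sq₀ (frobNorm_nonneg _) (by positivity), mul_pow, Real.sq_sqrt (by norm_num), h1, h2]
  have h3 : z.re ^ 2 ≤ ‖z‖ ^ 2 := sq_le_sq.2 (by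
    rw [abs_norm]; exact Complex.abs_re_le_norm z)
  nlinarith [sq_nonneg (1 - z.re)]

theorem traceRatio_partialTranspose {m n : ℕ} {θ : EuclideanSpace ℝ ((Fin m × Fin n) × Fin 2)}
    (hθ : θ ∈ paramSphere (Fin m × Fin n)) :
    traceRatio (applyOnA (transposeMap m) (pureState θ)) = 1 := by
  have n1 : ‖θ‖ = 1 := mem_sphere_zero_iff_norm.1 hθ
  rw [((isPositiveMap_transposeMap m).applyOnA_isHermitian (pureState_isHermitian θ)).traceRatio_eq,
    frobNorm_applyOnA_transposeMap, frobNorm_pureState]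
  have : (applyOnA (transposeMap m) (pureState θ)).trace = (pureState θ).trace := rfl
  rw [this, trace_pureState, n1]
  simp

theorem mainTheorem6 (dA dB : ℕ) (hA : 0 < dA) (hB : 0 < dB) :
    -- the bound for an arbitrary positive map whose normalized witness family is `l`-Lipschitz
    (∀ (N : Matrix (Fin dA) (Fin dA) ℂ →ₗ[ℂ] Matrix (Fin dA) (Fin dA) ℂ) (l : ℝ) (k : ℕ),
      IsPositiveMap N →
      (∀ θ ∈ paramSphere (Fin dA × Fin dB), applyOnA N (pureState θ) ≠ 0) →
      0 < l →
      IsLipschitzFrob (ι := Fin dA × Fin dB) l (mapWitness N) →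
      0 < k →
      ∃ αmin : ℝ, IsLeast (traceRatios dB N) αmin ∧
        detectionCapability k (paramSphere (Fin dA × Fin dB)) (mapWitness N) <
          2 * Real.exp
            (2 * ((dA * dB : ℕ) : ℝ) *
                Real.log ((2 : ℝ) ^ (5 / 2 : ℝ) * ((dA * dB : ℕ) : ℝ) ^ (3 / 2 : ℝ) * l) -
              (Real.sqrt (1 / 2 + αmin) - 1) ^ 2 * (k : ℝ))) ∧
    -- partial transposition
    (IsPositiveMap (transposeMap dA) ∧
      (∀ θ ∈ paramSphere (Fin dA × Fin dB),
        frobNorm (applyOnA (transposeMap dA) (pureState θ)) = 1) ∧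
      IsLipschitzFrob (ι := Fin dA × Fin dB) (Real.sqrt 2) (mapWitness (transposeMap dA)) ∧
      IsLeast (traceRatios dB (transposeMap dA)) 1) := by
  have : NeZero dA := ⟨hA.ne'⟩
  have : NeZero dB := ⟨hB.ne'⟩
  refine ⟨fun N l k hN hW _ hlip hk => ?_, isPositiveMap_transposeMap dA, ?_, ?_, ?_⟩
  · obtain ⟨a, ha⟩ := hN.exists_isLeast_traceRatios hW
    refine ⟨a, ha, ?_⟩
    obtain hB1 | hB2 : dB = 1 ∨ 2 ≤ dB := by omega
    · subst hB1
      rw [hN.detectionCapability_eq_zero]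
      positivity
    · have ha2 : 1 / 2 ≤ a := by
        obtain ⟨θ, hθ, rfl⟩ := ha.1
        exact hN.half_le_traceRatio (hW θ hθ)
      have h := detectionCapability_lt hk (fun θ _ => hN.mapWitness_isHermitian θ)
        (fun θ hθ => frobNorm_mapWitness (hW θ hθ)) ha2
        (fun θ hθ => (ha.2 ⟨θ, hθ, rfl⟩).trans_eq (hN.re_trace_mapWitness θ).symm)
        (one_le_of_isLipschitzFrob hB2 hW hlip) hlip
      rwa [Fintype.card_prod, Fintype.card_fin, Fintype.card_fin] at h
  · intro θ hθ
    rw [frobNorm_applyOnA_transposeMap, frobNorm_pureState, mem_sphere_zero_iff_norm.1 hθ, one_pow]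
  · intro θ hθ θ' hθ'
    have hw : ∀ ϑ ∈ paramSphere (Fin dA × Fin dB),
        mapWitness (transposeMap dA) ϑ = applyOnA (transposeMap dA) (pureState ϑ) := by
      intro ϑ hϑ
      rw [mapWitness, frobNorm_applyOnA_transposeMap, frobNorm_pureState,
        mem_sphere_zero_iff_norm.1 hϑ]
      simp
    have hsub : applyOnA (transposeMap dA) (pureState θ) -
        applyOnA (transposeMap dA) (pureState θ') =
        applyOnA (transposeMap dA) (pureState θ - pureState θ') := rfl
    rw [hw θ hθ, hw θ' hθ', hsub, frobNorm_applyOnA_transposeMap]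
    exact frobNorm_pureState_sub_le hθ hθ'
  · constructor
    · obtain ⟨θ, hθ⟩ := nonempty_paramSphere (Fin dA × Fin dB)
      exact ⟨θ, hθ, traceRatio_partialTranspose hθ⟩
    · rintro _ ⟨θ, hθ, rfl⟩
      exact (traceRatio_partialTranspose hθ).ge
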